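/- Let $(f(x))_{x\in\mathbb{R}}$ be a stationary, non-zero, centred Gaussian process on $\mathbb{R}$ whose sample paths are almost surely continuously differentiable, and let $K(x)=\mathbb{E}[f(0)f(x)]$ be its covariance kernel. For an interval $I\subset\mathbb{R}$ let $\mathcal{G}_I$ be the event that $f$ has no zero in $I$, and for $r>0$ define $$\phi_r=\sup_{(I_1,I_2)}\mathbb{P}\big[\mathcal{G}_{I_1}\cap\mathcal{G}_{I_2}\big],$$ where the supremum is over all pairs of compact intervals $I_1,I_2\subset\mathbb{R}$, each of length at least $r$, such that $I_1\cap I_2$ contains at most one point. Suppose that there are $c_0>0$ and $\alpha>1$ such that $|K(x)|\le c_0|x|^{-\alpha}$ for all $x\neq 0$. Then for every $\varepsilon>0$ there exists $c_1>0$ such that, for all sufficiently large $r$, $$\phi_r\le 4\,\mathbb{P}\big[f(x)>-\varepsilon \text{ for all } x\in[0,(1-\varepsilon)r]\big]^2+e^{-c_1 r^{(\alpha-1)/2}}.$$ (For $\varepsilon>1$ the interval $[0,(1-\varepsilon)r]$ is empty and the probability equals $1$.) -/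

import Mathlib

open MeasureTheory ProbabilityTheory Set Filter

/-- A stationary Gaussian process: a stationary (the finite-dimensional laws are invariant under
translations), non-zero, centred Gaussian process on the real line. -/
structure IsSGP {Ω : Type*} [MeasurableSpace Ω] (P : Measure Ω) (f : ℝ → Ω → ℝ) : Prop where
  gaussian : IsGaussianProcess f P
  centred : ∀ x : ℝ, ∫ ω, f x ω ∂P = 0
  stationary : ∀ (h : ℝ) (T : Finset ℝ),
    P.map (fun ω => fun x : T => f (x + h) ω) = P.map (fun ω => fun x : T => f x ω)
  nonzero : ¬ ∀ x : ℝ, f x =ᵐ[P] 0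

/-- The process is `C¹`-smooth: almost all of its sample paths are continuously differentiable. -/
def IsC1Process {Ω : Type*} [MeasurableSpace Ω] (P : Measure Ω) (f : ℝ → Ω → ℝ) : Prop :=
  ∀ᵐ ω ∂P, ContDiff ℝ 1 (fun x => f x ω)

/-- The covariance kernel `K(x) = 𝔼[f(0) f(x)]`. -/
noncomputable def covKernel {Ω : Type*} [MeasurableSpace Ω] (P : Measure Ω) (f : ℝ → Ω → ℝ)
    (x : ℝ) : ℝ :=
  ∫ ω, f 0 ω * f x ω ∂P

/-- The random zero set of the process. -/
def zeroSet {Ω : Type*} (f : ℝ → Ω → ℝ) (ω : Ω) : Set ℝ :=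
  {x : ℝ | f x ω = 0}

/-- The gap event that `I` contains no zero of the process. -/
def gapEvent {Ω : Type*} (f : ℝ → Ω → ℝ) (I : Set ℝ) : Set Ω :=
  {ω : Ω | I ∩ zeroSet f ω = ∅}

/-- The pairs of compact intervals, each of length at least `r`, that intersect in at most one
point. -/
def intervalPairs (r : ℝ) : Set (Set ℝ × Set ℝ) :=
  {p | ∃ a b c d : ℝ, a ≤ b ∧ c ≤ d ∧ p = (Icc a b, Icc c d) ∧
    r ≤ b - a ∧ r ≤ d - c ∧ (Icc a b ∩ Icc c d).Subsingleton}

/-- The gap clustering coefficient `φ_r`: the supremum of the probability that both intervals of a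
pair are free of zeros. The set of values is non-empty and, for a probability measure, contained in
`[0, 1]`, so this is a genuine supremum. -/
noncomputable def clusteringCoeff {Ω : Type*} [MeasurableSpace Ω] (P : Measure Ω)
    (f : ℝ → Ω → ℝ) (r : ℝ) : ℝ :=
  sSup ((fun p : Set ℝ × Set ℝ => P.real (gapEvent f p.1 ∩ gapEvent f p.2)) '' intervalPairs r)

/-! A path without zeros on an interval has a constant sign there, so two gaps split into four pairs
of sign events. Keep only the left end `[a, a + L]` of the first interval and the right end `[d - L,
d]` of the second, with `L = (1 - ε) r`. The kept pieces are at distance at least `2εr`, so their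
cross-covariances are at most `k = c₀ (2εr)^(-α)`.

On a lattice of mesh `r^(-β)`, `β = (α - 1) / 2`, the two pieces form a Gaussian vector with `N` of
order `r^(1+β)` entries. Sprinkling decouples them (`measureReal_forall_pos_le`): if `C` is the
change of covariance, independent noise of covariance `M = N k I` added to the coupled vector gives
the same law as noise of covariance `M + C` added to the decoupled one. Unless a noise entry is
large, this only lowers the level. The noise variance `N k` is of order `r^(-β)` because `1 + 2β =
α`, which gives the error `exp(-c r^β)` up to a polynomial factor.

Returning from the lattice to the interval costs the tail of difference quotients at height of order
`r^β`. This tail is Gaussian by Fernique's theorem, with constants uniform over finite families of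
steps and over base points. Stationarity and the symmetry of the law under `f ↦ -f` identify all
four products with the square of one persistence probability. -/

/-! ### Finite-dimensional Gaussian vectors -/

/-- The characteristic function of a centred Gaussian vector in terms of its covariances. -/
theorem charFun_map_toLp_of_centred {ι Ω : Type*} [Fintype ι] [MeasurableSpace Ω]
    {P : Measure Ω} {Z : ι → Ω → ℝ} (hZ : HasGaussianLaw (fun ω i => Z i ω) P)
    (h0 : ∀ i, ∫ ω, Z i ω ∂P = 0) (t : EuclideanSpace ℝ ι) :
    charFun (P.map (fun ω => WithLp.toLp 2 (fun i => Z i ω))) t =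
      Complex.exp (-((∑ i, ∑ j, t i * t j * cov[Z i, Z j; P] : ℝ) : ℂ) / 2) := by
  have := hZ.isProbabilityMeasure
  have hL := hZ.toLp_pi 2
  have hin : ∀ ω, inner ℝ t (WithLp.toLp 2 (fun i => Z i ω)) = ∑ i, t i * Z i ω := by
    intro ω
    simp [PiLp.inner_apply, mul_comm]
  rw [hL.charFun_map_eq]
  simp_rw [hin]
  have hmem : ∀ i, MemLp (fun ω => t i * Z i ω) 2 P :=
    fun i => (hZ.eval i).memLp_two.const_mul _
  have hmean : ∫ ω, ∑ i, t i * Z i ω ∂P = 0 := by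
    rw [integral_finsetSum _ fun i _ => (hmem i).integrable (by norm_num)]
    simp [integral_const_mul, h0]
  rw [hmean, variance_fun_sum hmem]
  simp_rw [covariance_const_mul_left, covariance_const_mul_right]
  congr 1
  simp only [Complex.ofReal_zero, zero_mul, zero_sub, neg_div, mul_assoc]

/-- Centred Gaussian vectors with the same covariances have the same law. -/
theorem map_toLp_eq_of_cov_eq {ι Ω Ω' : Type*} [Fintype ι] [MeasurableSpace Ω]
    [MeasurableSpace Ω'] {P : Measure Ω} {P' : Measure Ω'} {Z : ι → Ω → ℝ} {Z' : ι → Ω' → ℝ}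
    (hZ : HasGaussianLaw (fun ω i => Z i ω) P) (hZ' : HasGaussianLaw (fun ω i => Z' i ω) P')
    (h0 : ∀ i, ∫ ω, Z i ω ∂P = 0) (h0' : ∀ i, ∫ ω, Z' i ω ∂P' = 0)
    (hcov : ∀ i j, cov[Z i, Z j; P] = cov[Z' i, Z' j; P']) :
    P.map (fun ω => WithLp.toLp 2 (fun i => Z i ω)) =
      P'.map (fun ω => WithLp.toLp 2 (fun i => Z' i ω)) := by
  have := hZ.isProbabilityMeasure
  have := hZ'.isProbabilityMeasure
  apply Measure.ext_of_charFun
  ext t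
  rw [charFun_map_toLp_of_centred hZ h0, charFun_map_toLp_of_centred hZ' h0']
  simp_rw [hcov]

/-- Probabilities of events determined by a centred Gaussian vector depend only on its
covariances. -/
theorem measureReal_preimage_eq_of_cov_eq {ι Ω Ω' : Type*} [Fintype ι] [MeasurableSpace Ω]
    [MeasurableSpace Ω'] {P : Measure Ω} {P' : Measure Ω'} {Z : ι → Ω → ℝ} {Z' : ι → Ω' → ℝ}
    (hZ : HasGaussianLaw (fun ω i => Z i ω) P) (hZ' : HasGaussianLaw (fun ω i => Z' i ω) P')
    (h0 : ∀ i, ∫ ω, Z i ω ∂P = 0) (h0' : ∀ i, ∫ ω, Z' i ω ∂P' = 0)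
    (hcov : ∀ i j, cov[Z i, Z j; P] = cov[Z' i, Z' j; P'])
    {s : Set (ι → ℝ)} (hs : MeasurableSet s) :
    P.real {ω | (fun i => Z i ω) ∈ s} = P'.real {ω | (fun i => Z' i ω) ∈ s} := by
  have hs' : MeasurableSet ((WithLp.ofLp : EuclideanSpace ℝ ι → ι → ℝ) ⁻¹' s) :=
    hs.preimage (by fun_prop)
  have h := congrArg (fun m : Measure (EuclideanSpace ℝ ι) => m.real (WithLp.ofLp ⁻¹' s))
    (map_toLp_eq_of_cov_eq hZ hZ' h0 h0' hcov)
  simp only at h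
  rwa [measureReal_def, measureReal_def,
    Measure.map_apply_of_aemeasurable (hZ.toLp_pi 2).aemeasurable hs',
    Measure.map_apply_of_aemeasurable (hZ'.toLp_pi 2).aemeasurable hs'] at h

/-- A symmetric matrix with small entries becomes positive semidefinite after adding a suitable
multiple of the identity. -/
theorem posSemidef_smul_one_add_of_abs_le {ι : Type*} [Fintype ι] [DecidableEq ι]
    {C : Matrix ι ι ℝ} (hC : C.IsHermitian) {k : ℝ} (hk : ∀ i j, |C i j| ≤ k) :
    (((Fintype.card ι : ℝ) * k) • (1 : Matrix ι ι ℝ) + C).PosSemidef := by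
  refine Matrix.PosSemidef.of_dotProduct_mulVec_nonneg ?_ fun x => ?_
  · refine Matrix.IsHermitian.add ?_ hC
    rw [Matrix.IsHermitian, Matrix.conjTranspose_smul, Matrix.conjTranspose_one]
    simp
  rw [Matrix.add_mulVec, dotProduct_add, Matrix.smul_mulVec, Matrix.one_mulVec]
  -- Written as a sum over pairs, the scalar part dominates the quadratic form of `C` term by term,
  -- by `|x i * x j| ≤ (x i ^ 2 + x j ^ 2) / 2`.
  have h1 : star x ⬝ᵥ ((Fintype.card ι : ℝ) * k) • x
      = ∑ i, ∑ j : ι, k * ((x i ^ 2 + x j ^ 2) / 2) := by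
    have h3 : ∀ i, ∑ j : ι, k * ((x i ^ 2 + x j ^ 2) / 2)
        = (Fintype.card ι : ℝ) * k / 2 * x i ^ 2 + k / 2 * ∑ j, x j ^ 2 := by
      intro i
      rw [Finset.mul_sum, ← Finset.sum_congr rfl fun j _ =>
        show k / 2 * x i ^ 2 + k / 2 * x j ^ 2 = k * ((x i ^ 2 + x j ^ 2) / 2) by ring,
        Finset.sum_add_distrib]
      simp only [Finset.sum_const, Finset.card_univ, nsmul_eq_mul]
      ring
    simp_rw [h3]
    rw [Finset.sum_add_distrib, ← Finset.mul_sum]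
    simp only [star_trivial, dotProduct, Pi.smul_apply, smul_eq_mul, Finset.sum_const,
      Finset.card_univ, nsmul_eq_mul]
    rw [Finset.sum_congr rfl fun i _ => show x i * ((Fintype.card ι : ℝ) * k * x i)
      = ((Fintype.card ι : ℝ) * k) * x i ^ 2 by ring, ← Finset.mul_sum]
    ring
  have h2 : star x ⬝ᵥ C.mulVec x = ∑ i, ∑ j, C i j * (x i * x j) := by
    simp only [star_trivial, dotProduct, Matrix.mulVec, Finset.mul_sum]
    exact Finset.sum_congr rfl fun i _ => Finset.sum_congr rfl fun j _ => by ring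
  rw [h1, h2, ← Finset.sum_add_distrib]
  refine Finset.sum_nonneg fun i _ => ?_
  rw [← Finset.sum_add_distrib]
  refine Finset.sum_nonneg fun j _ => ?_
  have hxy : |x i * x j| ≤ (x i ^ 2 + x j ^ 2) / 2 := by
    rw [abs_le]
    constructor <;> nlinarith [sq_nonneg (x i + x j), sq_nonneg (x i - x j)]
  have h3 : |C i j * (x i * x j)| ≤ k * ((x i ^ 2 + x j ^ 2) / 2) := by
    rw [abs_mul]
    exact mul_le_mul (hk i j) hxy (abs_nonneg _) ((abs_nonneg _).trans (hk i j))
  linarith [neg_abs_le (C i j * (x i * x j))]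

/-- Gaussian upper tail bound. -/
theorem gaussianReal_real_Ici_le {v : ℝ} (hv : 0 < v) {t : ℝ} (ht : 0 ≤ t) :
    (gaussianReal 0 v.toNNReal).real (Ici t) ≤ Real.exp (-(t ^ 2) / (2 * v)) := by
  -- `t / v` is the optimal Chernoff exponent.
  have h := measure_ge_le_exp_mul_mgf (μ := gaussianReal 0 v.toNNReal) (X := id) (t := t / v) t
    (by positivity) (integrable_exp_mul_gaussianReal _)
  rw [mgf_gaussianReal Measure.map_id, ← Real.exp_add] at h
  refine h.trans_eq ?_
  congr 1
  rw [Real.coe_toNNReal _ hv.le]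
  field_simp
  ring

/-- Gaussian lower tail bound. -/
theorem gaussianReal_real_Iic_le {v : ℝ} (hv : 0 < v) {t : ℝ} (ht : 0 ≤ t) :
    (gaussianReal 0 v.toNNReal).real (Iic (-t)) ≤ Real.exp (-(t ^ 2) / (2 * v)) := by
  have h := measure_le_le_exp_mul_mgf (μ := gaussianReal 0 v.toNNReal) (X := id) (t := -(t / v))
    (-t) (by simp; positivity) (integrable_exp_mul_gaussianReal _)
  rw [mgf_gaussianReal Measure.map_id, ← Real.exp_add] at h
  refine h.trans_eq ?_
  congr 1
  rw [Real.coe_toNNReal _ hv.le]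
  field_simp
  ring

/-! ### Sprinkling and decoupling -/

/-- Perturbing by an independent vector, forwards. -/
theorem measureReal_le_conv_add {E : Type*} [AddCommGroup E] [MeasurableSpace E]
    [MeasurableAdd₂ E] (μ ρ : Measure E) [IsProbabilityMeasure μ] [IsProbabilityMeasure ρ]
    {U V B : Set E} (hV : MeasurableSet V)
    (h : ∀ x ∈ U, ∀ w, w ∉ B → x + w ∈ V) : μ.real U ≤ (μ ∗ ρ).real V + ρ.real B := by
  have h1 : μ.real U = (μ.prod ρ).real (U ×ˢ univ) := by simp [measureReal_prod_prod]
  have h2 : ρ.real B = (μ.prod ρ).real (univ ×ˢ B) := by simp [measureReal_prod_prod]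
  have h3 : (μ ∗ ρ).real V = (μ.prod ρ).real ((fun p : E × E => p.1 + p.2) ⁻¹' V) := by
    rw [measureReal_def, measureReal_def, Measure.conv, Measure.map_apply (by fun_prop) hV]
  rw [h1, h2, h3]
  refine (measureReal_mono ?_).trans (measureReal_union_le _ _)
  rintro ⟨x, w⟩ ⟨hx, -⟩
  by_cases hw : w ∈ B
  · exact Or.inr ⟨trivial, hw⟩
  · exact Or.inl (h x hx w hw)

/-- Perturbing by an independent vector, backwards. -/
theorem conv_measureReal_le_add {E : Type*} [AddCommGroup E] [MeasurableSpace E]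
    [MeasurableAdd₂ E] (μ ρ : Measure E) [IsProbabilityMeasure μ] [IsProbabilityMeasure ρ]
    {U V B : Set E} (hV : MeasurableSet V)
    (h : ∀ x w, x + w ∈ V → w ∉ B → x ∈ U) : (μ ∗ ρ).real V ≤ μ.real U + ρ.real B := by
  have h1 : μ.real U = (μ.prod ρ).real (U ×ˢ univ) := by simp [measureReal_prod_prod]
  have h2 : ρ.real B = (μ.prod ρ).real (univ ×ˢ B) := by simp [measureReal_prod_prod]
  have h3 : (μ ∗ ρ).real V = (μ.prod ρ).real ((fun p : E × E => p.1 + p.2) ⁻¹' V) := by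
    rw [measureReal_def, measureReal_def, Measure.conv, Measure.map_apply (by fun_prop) hV]
  rw [h1, h2, h3]
  refine (measureReal_mono ?_).trans (measureReal_union_le _ _)
  rintro ⟨x, w⟩ hx
  by_cases hw : w ∈ B
  · exact Or.inr ⟨trivial, hw⟩
  · exact Or.inl ⟨h x w hx hw, trivial⟩

/-- Union bound for the lower tails of a centred multivariate Gaussian. -/
theorem multivariateGaussian_real_exists_le {ι : Type*} [Fintype ι] [DecidableEq ι]
    {M : Matrix ι ι ℝ} (hM : M.PosSemidef) {v : ℝ} (hv : 0 < v) (hd : ∀ i, M i i = v)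
    {t : ℝ} (ht : 0 ≤ t) :
    (multivariateGaussian 0 M).real {w | ∃ i, w i ≤ -t} ≤
      Fintype.card ι * Real.exp (-(t ^ 2) / (2 * v)) := by
  rw [ofPred_exists]
  refine (measureReal_iUnion_fintype_le _).trans ?_
  refine (Finset.sum_le_card_nsmul _ _ (Real.exp (-(t ^ 2) / (2 * v))) fun i _ => ?_).trans_eq
    (by simp)
  have h := (measurePreserving_eval_multivariateGaussian (μ := 0) hM (i := i)).measureReal_preimage
    (measurableSet_Iic (a := -t)).nullMeasurableSet
  rw [hd i] at h
  exact h.trans_le (gaussianReal_real_Iic_le hv ht)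

/-- Union bound for the upper tails of a centred multivariate Gaussian. -/
theorem multivariateGaussian_real_exists_ge {ι : Type*} [Fintype ι] [DecidableEq ι]
    {M : Matrix ι ι ℝ} (hM : M.PosSemidef) {v : ℝ} (hv : 0 < v) (hd : ∀ i, M i i = v)
    {t : ℝ} (ht : 0 ≤ t) :
    (multivariateGaussian 0 M).real {w | ∃ i, t ≤ w i} ≤
      Fintype.card ι * Real.exp (-(t ^ 2) / (2 * v)) := by
  rw [ofPred_exists]
  refine (measureReal_iUnion_fintype_le _).trans ?_
  refine (Finset.sum_le_card_nsmul _ _ (Real.exp (-(t ^ 2) / (2 * v))) fun i _ => ?_).trans_eq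
    (by simp)
  have h := (measurePreserving_eval_multivariateGaussian (μ := 0) hM (i := i)).measureReal_preimage
    (measurableSet_Ici (a := t)).nullMeasurableSet
  rw [hd i] at h
  exact h.trans_le (gaussianReal_real_Ici_le hv ht)

/-- Sprinkled comparison: if two centred Gaussian vectors have the same variances and covariances
that differ by at most `k`, then their positivity probabilities are comparable after lowering the
level. -/
theorem measureReal_forall_pos_le {ι Ω Ω' : Type*} [Fintype ι] [MeasurableSpace Ω]
    [MeasurableSpace Ω'] {P : Measure Ω} {P' : Measure Ω'} {Z : ι → Ω → ℝ} {Z' : ι → Ω' → ℝ}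
    (hZ : HasGaussianLaw (fun ω i => Z i ω) P) (hZ' : HasGaussianLaw (fun ω i => Z' i ω) P')
    (h0 : ∀ i, ∫ ω, Z i ω ∂P = 0) (h0' : ∀ i, ∫ ω, Z' i ω ∂P' = 0)
    {k : ℝ} (hk : 0 < k) (hvar : ∀ i, cov[Z i, Z i; P] = cov[Z' i, Z' i; P'])
    (hcov : ∀ i j, |cov[Z i, Z j; P] - cov[Z' i, Z' j; P']| ≤ k) {t : ℝ} (ht : 0 ≤ t) :
    P.real {ω | ∀ i, 0 < Z i ω} ≤ P'.real {ω | ∀ i, -(2 * t) < Z' i ω} +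
      2 * (Fintype.card ι * Real.exp (-(t ^ 2) / (2 * (Fintype.card ι * k)))) := by
  classical
  have := hZ.isProbabilityMeasure
  have := hZ'.isProbabilityMeasure
  rcases isEmpty_or_nonempty ι with hι | hι
  · simp
  have hN : (0 : ℝ) < Fintype.card ι := by exact_mod_cast Fintype.card_pos
  have hv : 0 < Fintype.card ι * k := by positivity
  let C : Matrix ι ι ℝ := Matrix.of fun i j => cov[Z i, Z j; P] - cov[Z' i, Z' j; P']
  let M : Matrix ι ι ℝ := ((Fintype.card ι : ℝ) * k) • (1 : Matrix ι ι ℝ)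
  have hM : M.PosSemidef := Matrix.PosSemidef.one.smul hv.le
  have hM' : (M + C).PosSemidef := by
    refine posSemidef_smul_one_add_of_abs_le (Matrix.IsHermitian.ext fun i j => ?_) hcov
    simp [C, covariance_comm (Z i), covariance_comm (Z' i)]
  have hMd : ∀ i, M i i = Fintype.card ι * k := fun i => by simp [M]
  -- Equal variances make the diagonal of `C` vanish, so both noises have the same marginals.
  have hMd' : ∀ i, (M + C) i i = Fintype.card ι * k := fun i => by simp [M, C, hvar]
  let ν := P.map (fun ω => WithLp.toLp 2 (fun i => Z i ω))
  let ν' := P'.map (fun ω => WithLp.toLp 2 (fun i => Z' i ω))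
  have hνp : IsProbabilityMeasure ν := Measure.isProbabilityMeasure_map (hZ.toLp_pi 2).aemeasurable
  have hνp' : IsProbabilityMeasure ν' :=
    Measure.isProbabilityMeasure_map (hZ'.toLp_pi 2).aemeasurable
  let G : ℝ → Set (EuclideanSpace ℝ ι) := fun s => {x | ∀ i, -s < x i}
  have hG : ∀ s, MeasurableSet (G s) := fun s => by
    refine MeasurableSet.congr (s := ⋂ i, {x : EuclideanSpace ℝ ι | -s < x i})
      (MeasurableSet.iInter fun i => measurableSet_lt (by fun_prop) (by fun_prop)) ?_
    ext x
    simp [G]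
  -- Both sides are centred Gaussian with covariance `Cov Z + M = Cov Z' + (M + C)`.
  have hconv : ν ∗ multivariateGaussian 0 M = ν' ∗ multivariateGaussian 0 (M + C) := by
    apply Measure.ext_of_charFun
    ext x
    rw [charFun_conv, charFun_conv, charFun_map_toLp_of_centred hZ h0,
      charFun_map_toLp_of_centred hZ' h0', charFun_multivariateGaussian hM,
      charFun_multivariateGaussian hM', ← Complex.exp_add, ← Complex.exp_add]
    congr 1
    have hC : x.ofLp ⬝ᵥ C.mulVec x.ofLp = ∑ i, ∑ j, x i * x j * cov[Z i, Z j; P]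
        - ∑ i, ∑ j, x i * x j * cov[Z' i, Z' j; P'] := by
      rw [← Finset.sum_sub_distrib]
      simp only [dotProduct, Matrix.mulVec, Finset.mul_sum, ← Finset.sum_sub_distrib]
      exact Finset.sum_congr rfl fun i _ => Finset.sum_congr rfl fun j _ => by
        simp [C]; ring
    rw [Matrix.add_mulVec, dotProduct_add, hC]
    push_cast
    ring
  have e1 : P.real {ω | ∀ i, 0 < Z i ω} = ν.real (G 0) := by
    rw [measureReal_def, measureReal_def,
      Measure.map_apply_of_aemeasurable (hZ.toLp_pi 2).aemeasurable (hG 0)]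
    simp [G]
  have e2 : P'.real {ω | ∀ i, -(2 * t) < Z' i ω} = ν'.real (G (2 * t)) := by
    rw [measureReal_def, measureReal_def,
      Measure.map_apply_of_aemeasurable (hZ'.toLp_pi 2).aemeasurable (hG (2 * t))]
    simp [G]
  -- The level drops by `t` when the first noise is added and by `t` again when the second is
  -- removed.
  have i1 := measureReal_le_conv_add ν (multivariateGaussian 0 M) (U := G 0) (hG t)
    (B := {w | ∃ i, w i ≤ -t}) fun x hx w hw i => by
      have h1 := hx i
      have h2 : -t < w i := not_le.1 fun h => hw ⟨i, h⟩
      simp only [PiLp.add_apply]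
      linarith
  have i2 := conv_measureReal_le_add ν' (multivariateGaussian 0 (M + C)) (U := G (2 * t)) (hG t)
    (B := {w | ∃ i, t ≤ w i}) fun x w hx hw i => by
      have h1 : -t < x i + w i := hx i
      have h2 : w i < t := not_le.1 fun h => hw ⟨i, h⟩
      linarith
  have t1 := multivariateGaussian_real_exists_le hM hv hMd ht
  have t2 := multivariateGaussian_real_exists_ge hM' hv hMd' ht
  rw [hconv] at i1
  rw [e1, e2]
  linarith

/-- Sprinkled decoupling: two jointly Gaussian centred vectors with cross-covariances at most `k`
are, after lowering the level, almost independent for positivity events. -/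
theorem measureReal_forall_pos_and_le {ι Ω : Type*} [Fintype ι] [MeasurableSpace Ω]
    {P : Measure Ω} {X Y : ι → Ω → ℝ}
    (hXY : HasGaussianLaw (fun ω (i : ι ⊕ ι) => Sum.elim X Y i ω) P)
    (hX0 : ∀ i, ∫ ω, X i ω ∂P = 0) (hY0 : ∀ i, ∫ ω, Y i ω ∂P = 0)
    {k : ℝ} (hk : 0 < k) (hcov : ∀ i j, |cov[X i, Y j; P]| ≤ k) {t : ℝ} (ht : 0 ≤ t) :
    P.real {ω | (∀ i, 0 < X i ω) ∧ ∀ i, 0 < Y i ω} ≤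
      P.real {ω | ∀ i, -(2 * t) < X i ω} * P.real {ω | ∀ i, -(2 * t) < Y i ω} +
      2 * ((2 * Fintype.card ι) * Real.exp (-(t ^ 2) / (2 * ((2 * Fintype.card ι) * k)))) := by
  have := hXY.isProbabilityMeasure
  -- Independent copies on the product space keep the covariances within each block and cancel those
  -- across.
  let Z' : ι ⊕ ι → Ω × Ω → ℝ :=
    Sum.elim (fun i p => X i p.1) (fun i p => Y i p.2)
  have hX : HasGaussianLaw (fun ω i => X i ω) P :=
    hXY.map (ContinuousLinearMap.pi fun i => ContinuousLinearMap.proj (Sum.inl i))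
  have hY : HasGaussianLaw (fun ω i => Y i ω) P :=
    hXY.map (ContinuousLinearMap.pi fun i => ContinuousLinearMap.proj (Sum.inr i))
  have hXm := fun i => (hX.eval i).aemeasurable
  have hYm := fun i => (hY.eval i).aemeasurable
  have hfst : (P.prod P).map Prod.fst = P := measurePreserving_fst.map_eq
  have hsnd : (P.prod P).map Prod.snd = P := measurePreserving_snd.map_eq
  have hX1 : HasGaussianLaw (fun (p : Ω × Ω) i => X i p.1) (P.prod P) := ⟨by
    have h : (P.prod P).map (fun p i => X i p.1) = P.map (fun ω i => X i ω) := by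
      conv_rhs => rw [← hfst]
      rw [AEMeasurable.map_map_of_aemeasurable (by rw [hfst]; exact hX.aemeasurable)
        measurable_fst.aemeasurable]
      rfl
    rw [h]; exact hX.isGaussian_map⟩
  have hY1 : HasGaussianLaw (fun (p : Ω × Ω) i => Y i p.2) (P.prod P) := ⟨by
    have h : (P.prod P).map (fun p i => Y i p.2) = P.map (fun ω i => Y i ω) := by
      conv_rhs => rw [← hsnd]
      rw [AEMeasurable.map_map_of_aemeasurable (by rw [hsnd]; exact hY.aemeasurable)
        measurable_snd.aemeasurable]
      rfl
    rw [h]; exact hY.isGaussian_map⟩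
  have hZ' : HasGaussianLaw (fun p i => Z' i p) (P.prod P) := by
    have h := (indepFun_prod₀ hX.aemeasurable hY.aemeasurable).hasGaussianLaw hX1 hY1
    have h2 := h.map (ContinuousLinearMap.pi fun i : ι ⊕ ι => Sum.elim
      (fun i => (ContinuousLinearMap.proj i).comp (ContinuousLinearMap.fst ℝ (ι → ℝ) (ι → ℝ)))
      (fun i => (ContinuousLinearMap.proj i).comp (ContinuousLinearMap.snd ℝ (ι → ℝ) (ι → ℝ))) i)
    refine h2.congr (ae_of_all _ fun p => ?_)
    ext i
    cases i <;> rfl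
  have cXX : ∀ i j, cov[fun p : Ω × Ω => X i p.1, fun p => X j p.1; P.prod P]
      = cov[X i, X j; P] := fun i j => by
    have h := covariance_map_fun (μ := P.prod P) (Z := Prod.fst) (X := X i) (Y := X j)
      (by rw [hfst]; exact (hXm i).aestronglyMeasurable)
      (by rw [hfst]; exact (hXm j).aestronglyMeasurable) measurable_fst.aemeasurable
    rw [← h, hfst]
  have cYY : ∀ i j, cov[fun p : Ω × Ω => Y i p.2, fun p => Y j p.2; P.prod P]
      = cov[Y i, Y j; P] := fun i j => by
    have h := covariance_map_fun (μ := P.prod P) (Z := Prod.snd) (X := Y i) (Y := Y j)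
      (by rw [hsnd]; exact (hYm i).aestronglyMeasurable)
      (by rw [hsnd]; exact (hYm j).aestronglyMeasurable) measurable_snd.aemeasurable
    rw [← h, hsnd]
  have cXY : ∀ i j, cov[fun p : Ω × Ω => X i p.1, fun p => Y j p.2; P.prod P] = 0 :=
    fun i j => covariance_fst_snd_prod (hX.eval i).memLp_two (hY.eval j).memLp_two
  have h := measureReal_forall_pos_le (Z := Sum.elim X Y) (Z' := Z') hXY hZ'
    (by rintro (i | i) <;> simp [hX0, hY0])
    (by
      rintro (i | i)
      · simpa [Z', hX0] using integral_fun_fst (μ := P) (ν := P) (X i)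
      · simpa [Z', hY0] using integral_fun_snd (μ := P) (ν := P) (Y i))
    hk
    (by
      rintro (i | i)
      · simpa [Z'] using (cXX i i).symm
      · simpa [Z'] using (cYY i i).symm)
    (by
      rintro (i | i) (j | j)
      · simpa [Z', cXX] using hk.le
      · simpa [Z', cXY] using hcov i j
      · simpa [Z', covariance_comm (fun p : Ω × Ω => Y i p.2), cXY, covariance_comm (Y i)]
          using hcov j i
      · simpa [Z', cYY] using hk.le) ht
  have e1 : {ω | ∀ i, 0 < Sum.elim X Y i ω} = {ω | (∀ i, 0 < X i ω) ∧ ∀ i, 0 < Y i ω} := by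
    ext ω
    simp
  have e2 : {p | ∀ i, -(2 * t) < Z' i p} =
      {ω | ∀ i, -(2 * t) < X i ω} ×ˢ {ω | ∀ i, -(2 * t) < Y i ω} := by
    ext p
    simp [Z']
  rw [e1, e2, measureReal_prod_prod] at h
  simpa [two_mul] using h

/-! ### A dimension-free Fernique bound -/

/-- Fernique's theorem with constants uniform over all finite-dimensional centred Gaussian
vectors: a bound on a `3/4`-quantile of the maximum implies a Gaussian tail. -/
theorem exists_uniform_fernique :
    ∃ C c : ℝ, 0 < C ∧ 0 < c ∧ ∀ {ι : Type} {Ω : Type*} [Fintype ι] [MeasurableSpace Ω]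
      {P : Measure Ω} {Z : ι → Ω → ℝ}, HasGaussianLaw (fun ω i => Z i ω) P →
      (∀ i, ∫ ω, Z i ω ∂P = 0) → ∀ {a : ℝ}, 0 < a →
      P.real {ω | ∃ i, a < |Z i ω|} ≤ 1 / 4 → ∀ {u : ℝ}, 0 ≤ u →
      P.real {ω | ∃ i, u < |Z i ω|} ≤ C * Real.exp (-(c * (u / a) ^ 2)) := by
  let q : ENNReal := 3 / 4
  have hq1 : (2 : ENNReal)⁻¹ < q := by
    rw [← ENNReal.toReal_lt_toReal (by simp) (by simp [q, ENNReal.div_eq_top])]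
    simp [q]; norm_num
  have hq2 : q < 1 := by
    rw [← ENNReal.toReal_lt_toReal (by simp [q, ENNReal.div_eq_top]) (by simp)]
    simp [q]; norm_num
  -- The Fernique constant depends on `q` alone, so it can be fixed before the vector.
  let K : ENNReal := .ofReal (Real.exp (Fernique.logRatio q))
        + ∑' n : ℕ, .ofReal (Real.exp (-2⁻¹ * Real.log (q / (1 - q)).toReal * 2 ^ n))
  have hq3 : (q / (1 - q)).toReal = 3 := by
    rw [ENNReal.toReal_div, ENNReal.toReal_sub_of_le hq2.le (by simp)]
    simp [q]; norm_num
  have hK : K ≠ ⊤ := by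
    refine (ENNReal.add_lt_top.mpr ⟨ENNReal.ofReal_lt_top, ?_⟩).ne
    refine Summable.tsum_ofReal_lt_top <|
      Real.summable_exp_nat_mul_of_ge ?_ (fun i ↦ mod_cast (Nat.lt_pow_self (by simp)).le)
    rw [hq3]
    exact mul_neg_of_neg_of_pos (by simp) (Real.log_pos (by norm_num))
  refine ⟨K.toReal + 1, Fernique.logRatio q, by positivity, Fernique.logRatio_pos hq1 hq2, ?_⟩
  intro ι Ω _ _ P Z hZ h0 a ha hPa u hu
  have := hZ.isProbabilityMeasure
  let μ := P.map (fun ω i => Z i ω)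
  have hμ : IsGaussian μ := hZ.isGaussian_map
  have hmean : μ[id] = 0 := by
    rw [integral_map hZ.aemeasurable (by fun_prop)]
    ext i
    change (∫ ω, (fun i => Z i ω) ∂P) i = 0
    rw [eval_integral fun i => (hZ.eval i).integrable]
    exact h0 i
  have hnorm : ∀ b : ℝ, 0 ≤ b → P.real {ω | ∃ i, b < |Z i ω|} = μ.real {x | b < ‖x‖} := by
    intro b hb
    rw [measureReal_def, measureReal_def, Measure.map_apply_of_aemeasurable hZ.aemeasurable
      (measurableSet_lt (by fun_prop) (by fun_prop))]
    congr 2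
    ext ω
    have h := (pi_norm_le_iff_of_nonneg (x := fun i => Z i ω) hb).not
    simp only [not_le, not_forall, Real.norm_eq_abs] at h
    exact h.symm
  -- Rotation invariance of two independent copies is the only Gaussian input to Fernique's
  -- argument.
  have hrot := IsGaussian.map_rotation_eq_self hmean (-(Real.pi / 4))
  have hqa : q ≤ μ {x | ‖x‖ ≤ a} := by
    rw [hnorm a ha.le] at hPa
    have hc : {x : ι → ℝ | ‖x‖ ≤ a} = {x | a < ‖x‖}ᶜ := by ext; simp
    have h := probReal_compl_eq_one_sub (μ := μ) (s := {x : ι → ℝ | a < ‖x‖})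
      (measurableSet_lt (by fun_prop) (by fun_prop))
    rw [← hc] at h
    rw [← ENNReal.toReal_le_toReal (by simp [q, ENNReal.div_eq_top]) (by simp),
      ← measureReal_def, h]
    simp only [q, ENNReal.toReal_div]
    norm_num
    linarith
  have hF := lintegral_exp_mul_sq_norm_le_of_map_rotation_eq_self hrot hqa hq1
  change _ ≤ K at hF
  rw [hnorm u hu]
  have hM := meas_ge_le_lintegral_div (μ := μ)
    (f := fun x => ENNReal.ofReal (Real.exp (Fernique.logRatio q * a⁻¹ ^ 2 * ‖x‖ ^ 2)))
    (by fun_prop) (ε := ENNReal.ofReal (Real.exp (Fernique.logRatio q * (u / a) ^ 2)))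
    (by simp [Real.exp_pos]) (by simp)
  have hsub : μ {x | u < ‖x‖} ≤ μ {x | ENNReal.ofReal (Real.exp (Fernique.logRatio q * (u / a) ^ 2))
      ≤ ENNReal.ofReal (Real.exp (Fernique.logRatio q * a⁻¹ ^ 2 * ‖x‖ ^ 2))} := by
    refine measure_mono fun x (hx : u < ‖x‖) => ?_
    refine ENNReal.ofReal_le_ofReal (Real.exp_le_exp.2 ?_)
    rw [div_eq_inv_mul, mul_pow, ← mul_assoc]
    have := (Fernique.logRatio_pos hq1 hq2).le
    gcongr
  have hfin := (hsub.trans hM).trans (ENNReal.div_le_div_right hF _)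
  have h := ENNReal.toReal_mono (ENNReal.div_ne_top hK (by simp [Real.exp_pos])) hfin
  rw [ENNReal.toReal_div, ENNReal.toReal_ofReal (Real.exp_pos _).le] at h
  rw [measureReal_def, Real.exp_neg, ← div_eq_mul_inv]
  exact h.trans (by gcongr; linarith)

/-! ### Covariances of the stationary process -/

namespace IsSGP

variable {Ω : Type*} [MeasurableSpace Ω] {P : Measure Ω} {f : ℝ → Ω → ℝ}

theorem memLp_two (hf : IsSGP P f) (x : ℝ) : MemLp (f x) 2 P :=
  (hf.gaussian.hasGaussianLaw_eval x).memLp_two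

theorem integrable (hf : IsSGP P f) (x : ℝ) : Integrable (f x) P :=
  (hf.gaussian.hasGaussianLaw_eval x).integrable

theorem integral_mul_eq_covKernel (hf : IsSGP P f) (a b : ℝ) :
    ∫ ω, f a ω * f b ω ∂P = covKernel P f (b - a) := by
  classical
  let T : Finset ℝ := {0, b - a}
  have h0 : (0 : ℝ) ∈ T := by simp [T]
  have h1 : b - a ∈ T := by simp [T]
  have hm : ∀ h : ℝ, AEMeasurable (fun ω => fun x : T => f (x + h) ω) P := fun h =>
    aemeasurable_pi_lambda _ fun x => hf.gaussian.aemeasurable _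
  have key : ∀ h : ℝ, ∫ ω, f (0 + h) ω * f (b - a + h) ω ∂P =
      ∫ g, g ⟨0, h0⟩ * g ⟨b - a, h1⟩ ∂(P.map (fun ω => fun x : T => f (x + h) ω)) := fun h => by
    rw [integral_map (hm h) (by fun_prop)]
  have e1 := key a
  have e2 := key 0
  rw [hf.stationary a T] at e1
  simp only [add_zero] at e2
  rw [← e2] at e1
  simpa [covKernel] using e1

theorem covariance_eq_covKernel (hf : IsSGP P f) (a b : ℝ) :
    cov[f a, f b; P] = covKernel P f (b - a) := by
  have := hf.gaussian.isProbabilityMeasure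
  rw [covariance_eq_sub (hf.memLp_two a) (hf.memLp_two b), hf.centred, hf.centred, mul_zero,
    sub_zero, ← hf.integral_mul_eq_covKernel]
  rfl

end IsSGP

/-! ### Tails of difference quotients -/

/-- The event that some rational difference quotient of the process at `s`, with step in `(0, 1)`,
exceeds `u`. -/
def incrementEvent {Ω : Type*} (f : ℝ → Ω → ℝ) (s u : ℝ) : Set Ω :=
  {ω | ∃ q : {q : ℚ // 0 < q ∧ q < 1}, u < |(f (s + (q : ℚ)) ω - f s ω) / (q : ℚ)|}

/-- Rational steps make the event a countable union; the coordinates of `f` are only almost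
everywhere measurable. -/
theorem nullMeasurableSet_incrementEvent {Ω : Type*} [MeasurableSpace Ω] {P : Measure Ω}
    {f : ℝ → Ω → ℝ} (hf : IsSGP P f) (s u : ℝ) : NullMeasurableSet (incrementEvent f s u) P := by
  rw [incrementEvent, ofPred_exists]
  refine NullMeasurableSet.iUnion fun q => nullMeasurableSet_lt aemeasurable_const ?_
  have h1 := hf.gaussian.aemeasurable (s + (q : ℚ))
  have h2 := hf.gaussian.aemeasurable s
  exact ((h1.sub h2).div_const _).abs

/-- The rational difference quotients at `0` are bounded with high probability. -/
theorem exists_incrementEvent_le {Ω : Type*} [MeasurableSpace Ω] {P : Measure Ω}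
    {f : ℝ → Ω → ℝ} (hf : IsSGP P f) (hC1 : IsC1Process P f) :
    ∃ a : ℝ, 0 < a ∧ P.real (incrementEvent f 0 a) ≤ 1 / 4 := by
  have := hf.gaussian.isProbabilityMeasure
  have hanti : Antitone fun n : ℕ => incrementEvent f 0 (n : ℝ) := by
    rintro m n hmn ω ⟨q, hq⟩
    exact ⟨q, lt_of_le_of_lt (by exact_mod_cast hmn) hq⟩
  have hlim := tendsto_measure_iInter_atTop (μ := P)
    (fun n : ℕ => nullMeasurableSet_incrementEvent hf 0 (n : ℝ)) hanti ⟨0, measure_ne_top _ _⟩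
  -- A `C¹` path is Lipschitz on `[0, 1]`, so its quotients at `0` are bounded.
  have hnull : P (⋂ n : ℕ, incrementEvent f 0 (n : ℝ)) = 0 := by
    refine measure_mono_null (fun ω hω => ?_) hC1
    intro hd
    obtain ⟨K, hK⟩ := hd.locallyLipschitz.locallyLipschitzOn.exists_lipschitzOnWith_of_compact
      (isCompact_Icc (a := (0 : ℝ)) (b := 1))
    obtain ⟨n, hn⟩ := exists_nat_ge (K : ℝ)
    obtain ⟨⟨q, hq0, hq1⟩, hq⟩ := mem_iInter.1 hω n
    have hq0' : (0 : ℝ) < q := by exact_mod_cast hq0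
    have hq1' : (q : ℝ) < 1 := by exact_mod_cast hq1
    have h := hK.dist_le_mul (0 + (q : ℝ)) ⟨by linarith, by linarith⟩ 0 (by simp)
    rw [Real.dist_eq, Real.dist_eq] at h
    simp only at hq
    rw [abs_div, abs_of_pos hq0', lt_div_iff₀ hq0'] at hq
    rw [show (0 : ℝ) + q - 0 = q by ring, abs_of_pos hq0'] at h
    nlinarith
  rw [hnull] at hlim
  obtain ⟨n, hn, hn1⟩ := ((hlim.eventually_le_const
    (show (0 : ENNReal) < ENNReal.ofReal (1 / 4) by simp)).and (eventually_ge_atTop 1)).exists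
  exact ⟨n, by exact_mod_cast hn1, ENNReal.toReal_le_of_le_ofReal (by norm_num) hn⟩

/-- The difference quotients of a stationary `C¹` Gaussian process have Gaussian tails. -/
theorem exists_incrementEvent_tail {Ω : Type*} [MeasurableSpace Ω] {P : Measure Ω}
    {f : ℝ → Ω → ℝ} (hf : IsSGP P f) (hC1 : IsC1Process P f) :
    ∃ C c : ℝ, 0 < C ∧ 0 < c ∧ ∀ s u : ℝ, 0 ≤ u →
      P.real (incrementEvent f s u) ≤ C * Real.exp (-(c * u ^ 2)) := by
  classical
  have := hf.gaussian.isProbabilityMeasure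
  obtain ⟨a, ha, hPa⟩ := exists_incrementEvent_le hf hC1
  obtain ⟨C, c, hC, hc, hF⟩ := exists_uniform_fernique
  let I := {q : ℚ // 0 < q ∧ q < 1}
  let Z : ℝ → I → Ω → ℝ := fun s q ω => (f (s + (q : ℚ)) ω - f s ω) / (q : ℚ)
  have hG : ∀ s (T : Finset I), HasGaussianLaw (fun ω (q : T) => Z s q ω) P := by
    intro s T
    refine (hf.gaussian.of_isGaussianProcess (Y := Z s) fun q => ?_).hasGaussianLaw T
    refine ⟨{s, s + (q : ℚ)}, ((q : ℚ) : ℝ)⁻¹ •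
      (ContinuousLinearMap.proj (R := ℝ) (φ := fun _ => ℝ) ⟨s + (q : ℚ), by simp⟩ -
        ContinuousLinearMap.proj (R := ℝ) (φ := fun _ => ℝ) ⟨s, by simp⟩), fun ω => ?_⟩
    simp [Z, div_eq_inv_mul]
  have h0 : ∀ s q, ∫ ω, Z s q ω ∂P = 0 := by
    intro s q
    simp only [Z]
    rw [integral_div, integral_sub (hf.integrable _) (hf.integrable _), hf.centred, hf.centred]
    simp
  have hcov : ∀ s p q, cov[Z s p, Z s q; P] = cov[Z 0 p, Z 0 q; P] := by
    intro s p q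
    simp only [Z]
    rw [covariance_fun_div_left, covariance_fun_div_right, covariance_fun_div_left,
      covariance_fun_div_right,
      covariance_fun_sub_fun_sub (hf.memLp_two _) (hf.memLp_two _) (hf.memLp_two _) (hf.memLp_two _),
      covariance_fun_sub_fun_sub (hf.memLp_two _) (hf.memLp_two _) (hf.memLp_two _) (hf.memLp_two _)]
    simp only [hf.covariance_eq_covKernel]
    simp
  have hfin : ∀ s u, 0 ≤ u → ∀ T : Finset I,
      P.real {ω | ∃ q : T, u < |Z s q ω|} ≤ C * Real.exp (-(c / a ^ 2 * u ^ 2)) := by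
    intro s u hu T
    have hms : MeasurableSet {z : T → ℝ | ∃ q, u < |z q|} := by
      rw [ofPred_exists]
      exact MeasurableSet.iUnion fun q => measurableSet_lt (by fun_prop) (by fun_prop)
    -- Stationarity moves the base point to `0`, where the quantile `a` was chosen once and for all.
    have e := measureReal_preimage_eq_of_cov_eq (hG s T) (hG 0 T) (fun q => h0 s q)
      (fun q => h0 0 q) (fun p q => hcov s p q) hms
    have hle : P.real {ω | ∃ q : T, a < |Z 0 q ω|} ≤ 1 / 4 :=
      (measureReal_mono (by rintro ω ⟨q, hq⟩; exact ⟨q, hq⟩)).trans hPa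
    have hF' := hF (hG 0 T) (fun q => h0 0 q) ha hle hu
    rw [show c / a ^ 2 * u ^ 2 = c * (u / a) ^ 2 by field_simp]
    exact e.trans_le hF'
  refine ⟨C, c / a ^ 2, hC, by positivity, fun s u hu => ?_⟩
  -- The bound is uniform in `T`, so it passes to the directed union of finite families.
  have hU : incrementEvent f s u = ⋃ T : Finset I, {ω | ∃ q : T, u < |Z s q ω|} := by
    ext ω
    simp only [incrementEvent, mem_ofPred_eq, mem_iUnion]
    constructor
    · rintro ⟨q, hq⟩
      exact ⟨{q}, ⟨q, by simp⟩, hq⟩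
    · rintro ⟨T, q, hq⟩
      exact ⟨q, hq⟩
  have hdir : Directed (· ⊆ ·) fun T : Finset I => {ω | ∃ q : T, u < |Z s q ω|} := by
    refine Monotone.directed_le fun T T' h => ?_
    rintro ω ⟨q, hq⟩
    exact ⟨⟨q, h q.2⟩, hq⟩
  rw [measureReal_def, hU, hdir.measure_iUnion]
  refine ENNReal.toReal_le_of_le_ofReal (by positivity) (iSup_le fun T => ?_)
  rw [← ofReal_measureReal]
  exact ENNReal.ofReal_le_ofReal (hfin s u hu T)

/-- Rational steps are dense and the inequality is closed under limits for a continuous path. -/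
theorem abs_sub_le_of_notMem_incrementEvent {Ω : Type*} {f : ℝ → Ω → ℝ} {ω : Ω}
    (hω : Continuous fun x => f x ω) {s u : ℝ} (h : ω ∉ incrementEvent f s u) {y : ℝ}
    (hy0 : 0 ≤ y) (hy1 : y < 1) : |f (s + y) ω - f s ω| ≤ u * y := by
  rcases hy0.eq_or_lt with rfl | hy
  · simp
  have hcl : IsClosed {y : ℝ | |f (s + y) ω - f s ω| ≤ u * y} :=
    isClosed_le (by fun_prop) (by fun_prop)
  have hd := Rat.denseRange_cast (𝕜 := ℝ)
  have hmem := hd.open_subset_closure_inter (isOpen_Ioo (a := (0 : ℝ)) (b := 1))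
    ⟨hy, hy1⟩
  refine closure_minimal ?_ hcl hmem
  rintro _ ⟨⟨hq0, hq1⟩, q, rfl⟩
  have hq : ¬ u < |(f (s + (q : ℝ)) ω - f s ω) / (q : ℝ)| := fun hq =>
    h ⟨⟨q, by exact_mod_cast hq0, by exact_mod_cast hq1⟩, hq⟩
  rw [not_lt, abs_div, abs_of_pos hq0, div_le_iff₀ hq0] at hq
  exact hq

/-! ### Discretisation and symmetries -/

/-- Points of the lattice with mesh `h`, truncated at `L`. -/
noncomputable def latticePoint (h L : ℝ) (i : ℕ) : ℝ := min (i * h) L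

theorem latticePoint_mem {h L : ℝ} (hh : 0 ≤ h) (hL : 0 ≤ L) (i : ℕ) :
    latticePoint h L i ∈ Icc 0 L :=
  ⟨le_min (by positivity) hL, min_le_right _ _⟩

section

variable {Ω : Type*} [MeasurableSpace Ω] {P : Measure Ω} {f : ℝ → Ω → ℝ}

/-- Passing from persistence on a lattice to persistence on an interval. -/
theorem measureReal_lattice_le (hf : IsSGP P f) (hC1 : IsC1Process P f) {h L ε u B : ℝ} {n : ℕ}
    (hh0 : 0 < h) (hh1 : h ≤ 1) (hn : L ≤ n * h) (hu : 0 ≤ u) (huh : u * h ≤ ε / 2)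
    (hB : ∀ s, P.real (incrementEvent f s u) ≤ B) :
    P.real {ω | ∀ i : Fin (n + 1), -(ε / 2) < f (latticePoint h L i) ω} ≤
      P.real {ω | ∀ x ∈ Icc (0 : ℝ) L, -ε < f x ω} + (n + 1) * B := by
  have := hf.gaussian.isProbabilityMeasure
  have hN : P.real {ω | ¬ ContDiff ℝ 1 (fun x => f x ω)} = 0 := by
    rw [measureReal_def, ae_iff.1 hC1]; rfl
  have hsub : {ω | ∀ i : Fin (n + 1), -(ε / 2) < f (latticePoint h L i) ω} ⊆
      ({ω | ∀ x ∈ Icc (0 : ℝ) L, -ε < f x ω} ∪ {ω | ¬ ContDiff ℝ 1 (fun x => f x ω)}) ∪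
        ⋃ i : Fin (n + 1), incrementEvent f (latticePoint h L i) u := by
    intro ω hω
    by_contra hcon
    simp only [mem_union, not_or, mem_iUnion, not_exists] at hcon
    obtain ⟨⟨h1, h2⟩, h3⟩ := hcon
    refine h1 fun x hx => ?_
    have hc : Continuous fun x => f x ω := (not_not.1 h2).continuous
    have hxh : 0 ≤ x / h := div_nonneg hx.1 hh0.le
    have hi1 : (⌊x / h⌋₊ : ℝ) * h ≤ x := (le_div_iff₀ hh0).1 (Nat.floor_le hxh)
    have hi2 : x < (⌊x / h⌋₊ + 1 : ℝ) * h := (div_lt_iff₀ hh0).1 (Nat.lt_floor_add_one _)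
    have hin : ⌊x / h⌋₊ < n + 1 := by
      refine Nat.lt_succ_of_le (Nat.floor_le_of_le ?_)
      rw [div_le_iff₀ hh0]
      exact hx.2.trans hn
    -- The lattice point just left of `x` is not affected by the truncation at `L`.
    have hp : latticePoint h L ⌊x / h⌋₊ = ⌊x / h⌋₊ * h := min_eq_left (hi1.trans hx.2)
    have h4 := hω ⟨_, hin⟩
    have h5 := h3 ⟨_, hin⟩
    simp only [hp] at h4 h5
    have h6 := abs_sub_le_of_notMem_incrementEvent hc h5 (y := x - ⌊x / h⌋₊ * h) (by linarith)
      (by linarith)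
    rw [add_sub_cancel] at h6
    have h7 : u * (x - ⌊x / h⌋₊ * h) ≤ u * h := mul_le_mul_of_nonneg_left (by linarith) hu
    have h8 := (abs_le.1 h6).1
    linarith
  have hun : P.real (⋃ i : Fin (n + 1), incrementEvent f (latticePoint h L i) u) ≤ (n + 1) * B := by
    refine (measureReal_iUnion_fintype_le _).trans ?_
    refine (Finset.sum_le_card_nsmul _ _ B fun i _ => hB _).trans_eq (by simp)
  have h1 := (measureReal_mono (μ := P) hsub).trans (measureReal_union_le _ _)
  have h2 := measureReal_union_le (μ := P) {ω | ∀ x ∈ Icc (0 : ℝ) L, -ε < f x ω}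
    {ω | ¬ ContDiff ℝ 1 (fun x => f x ω)}
  linarith

/-- The points may repeat, as they can in the truncated lattice, so the vector is taken as a linear
image of the process on the finite set of values of `x`. -/
theorem hasGaussianLaw_signed_shift (hf : IsSGP P f) {ι : Type*} [Fintype ι]
    (σ x : ι → ℝ) : HasGaussianLaw (fun ω i => σ i * f (x i) ω) P := by
  classical
  have h := hf.gaussian.hasGaussianLaw (Finset.univ.image x)
  refine (h.map (ContinuousLinearMap.pi fun i => σ i •
    ContinuousLinearMap.proj (R := ℝ) (φ := fun _ => ℝ) ⟨x i, by simp⟩)).congr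
    (ae_of_all _ fun ω => ?_)
  ext i
  simp [Finset.restrict_def]

/-- Lattice persistence probabilities are invariant under shifts and sign changes. -/
theorem measureReal_signed_shift_eq (hf : IsSGP P f) {ι : Type*} [Fintype ι] (x : ι → ℝ)
    {σ : ℝ} (hσ : σ * σ = 1) (s l : ℝ) :
    P.real {ω | ∀ i, l < σ * f (s + x i) ω} = P.real {ω | ∀ i, l < f (x i) ω} := by
  have hms : MeasurableSet {z : ι → ℝ | ∀ i, l < z i} := by
    rw [ofPred_forall]
    exact MeasurableSet.iInter fun i => measurableSet_lt (by fun_prop) (by fun_prop)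
  have h1 := hasGaussianLaw_signed_shift hf (fun _ : ι => σ) (fun i => s + x i)
  have h2 := hasGaussianLaw_signed_shift hf (fun _ : ι => (1 : ℝ)) x
  have h := measureReal_preimage_eq_of_cov_eq h1 h2
    (fun i => by rw [integral_const_mul, hf.centred, mul_zero])
    (fun i => by rw [integral_const_mul, hf.centred, mul_zero])
    (fun i j => by
      rw [covariance_const_mul_left, covariance_const_mul_right, covariance_const_mul_left,
        covariance_const_mul_right, ← mul_assoc, hσ]
      change 1 * cov[f (s + x i), f (s + x j); P] = 1 * (1 * cov[f (x i), f (x j); P])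
      simp [hf.covariance_eq_covKernel]) hms
  simpa using h

/-- Decoupling of signed positivity events on two separated point sets. -/
theorem measureReal_signed_pos_and_le (hf : IsSGP P f) {ι : Type*} [Fintype ι] (x : ι → ℝ)
    {σ τ : ℝ} (hσ : σ * σ = 1) (hτ : τ * τ = 1) (s₁ s₂ : ℝ) {k : ℝ} (hk : 0 < k)
    (hcov : ∀ i j, |covKernel P f (s₂ + x j - (s₁ + x i))| ≤ k) {t : ℝ} (ht : 0 ≤ t) :
    P.real {ω | (∀ i, 0 < σ * f (s₁ + x i) ω) ∧ ∀ i, 0 < τ * f (s₂ + x i) ω} ≤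
      P.real {ω | ∀ i, -(2 * t) < f (x i) ω} ^ 2 +
      2 * ((2 * Fintype.card ι) * Real.exp (-(t ^ 2) / (2 * ((2 * Fintype.card ι) * k)))) := by
  have habs : |σ * τ| = 1 := by
    rw [← sq_eq_sq₀ (abs_nonneg _) zero_le_one, sq_abs]
    linear_combination τ * τ * hσ + hτ
  have hG : HasGaussianLaw (fun ω (i : ι ⊕ ι) => Sum.elim (fun i ω => σ * f (s₁ + x i) ω)
      (fun i ω => τ * f (s₂ + x i) ω) i ω) P := by
    refine (hasGaussianLaw_signed_shift hf (Sum.elim (fun _ : ι => σ) (fun _ : ι => τ))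
      (Sum.elim (fun i => s₁ + x i) (fun i => s₂ + x i))).congr (ae_of_all _ fun ω => ?_)
    ext i
    cases i <;> rfl
  have h := measureReal_forall_pos_and_le hG
    (fun i => by rw [integral_const_mul, hf.centred, mul_zero])
    (fun i => by rw [integral_const_mul, hf.centred, mul_zero]) hk
    (fun i j => by
      rw [covariance_const_mul_left, covariance_const_mul_right, ← mul_assoc, abs_mul, habs,
        one_mul]
      change |cov[f (s₁ + x i), f (s₂ + x j); P]| ≤ k
      rw [hf.covariance_eq_covKernel]
      exact hcov i j) ht
  rwa [measureReal_signed_shift_eq hf x hσ, measureReal_signed_shift_eq hf x hτ, ← sq] at h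

/-! ### From gaps to sign events -/

/-- A continuous function without zeros on an interval has a constant sign there. -/
theorem exists_sign_of_forall_ne_zero {g : ℝ → ℝ} (hg : Continuous g) {a b : ℝ}
    (h : ∀ x ∈ Icc a b, g x ≠ 0) :
    (∀ x ∈ Icc a b, 0 < 1 * g x) ∨ ∀ x ∈ Icc a b, 0 < -1 * g x := by
  by_contra! hcon
  obtain ⟨⟨x, hx, hgx⟩, y, hy, hgy⟩ := hcon
  obtain ⟨z, hz, hz0⟩ := isPreconnected_Icc.intermediate_value hx hy hg.continuousOn
    (show (0 : ℝ) ∈ Icc (g x) (g y) from ⟨by linarith, by linarith⟩)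
  exact h z hz hz0

/-- Bound on the probability of two gaps by lattice sign events. -/
theorem measureReal_gap_inter_gap_le [IsProbabilityMeasure P] (hC1 : IsC1Process P f)
    {a b c d : ℝ} {ι : Type*} (y z : ι → ℝ) (hy : ∀ i, y i ∈ Icc a b) (hz : ∀ i, z i ∈ Icc c d)
    {q : ℝ} (hq : ∀ σ τ : ℝ, σ * σ = 1 → τ * τ = 1 →
      P.real {ω | (∀ i, 0 < σ * f (y i) ω) ∧ ∀ i, 0 < τ * f (z i) ω} ≤ q) :
    P.real (gapEvent f (Icc a b) ∩ gapEvent f (Icc c d)) ≤ 4 * q := by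
  have hN : P.real {ω | ¬ ContDiff ℝ 1 (fun x => f x ω)} = 0 := by
    rw [measureReal_def, ae_iff.1 hC1]; rfl
  let E : ℝ → ℝ → Set Ω := fun σ τ =>
    {ω | (∀ i, 0 < σ * f (y i) ω) ∧ ∀ i, 0 < τ * f (z i) ω}
  have hsub : gapEvent f (Icc a b) ∩ gapEvent f (Icc c d) ⊆
      {ω | ¬ ContDiff ℝ 1 (fun x => f x ω)} ∪
        ((E 1 1 ∪ E 1 (-1)) ∪ (E (-1) 1 ∪ E (-1) (-1))) := by
    rintro ω ⟨h1, h2⟩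
    by_cases hω : ContDiff ℝ 1 (fun x => f x ω)
    swap
    · exact Or.inl hω
    have n1 : ∀ x ∈ Icc a b, f x ω ≠ 0 := fun x hx h0 => by
      have : x ∈ Icc a b ∩ zeroSet f ω := ⟨hx, h0⟩
      rw [h1] at this
      exact this
    have n2 : ∀ x ∈ Icc c d, f x ω ≠ 0 := fun x hx h0 => by
      have : x ∈ Icc c d ∩ zeroSet f ω := ⟨hx, h0⟩
      rw [h2] at this
      exact this
    right
    rcases exists_sign_of_forall_ne_zero hω.continuous n1 with p1 | p1 <;>
    rcases exists_sign_of_forall_ne_zero hω.continuous n2 with p2 | p2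
    · exact Or.inl (Or.inl ⟨fun i => p1 _ (hy i), fun i => p2 _ (hz i)⟩)
    · exact Or.inl (Or.inr ⟨fun i => p1 _ (hy i), fun i => p2 _ (hz i)⟩)
    · exact Or.inr (Or.inl ⟨fun i => p1 _ (hy i), fun i => p2 _ (hz i)⟩)
    · exact Or.inr (Or.inr ⟨fun i => p1 _ (hy i), fun i => p2 _ (hz i)⟩)
  have h1 := (measureReal_mono (μ := P) hsub).trans (measureReal_union_le _ _)
  have h2 := measureReal_union_le (μ := P) (E 1 1 ∪ E 1 (-1)) (E (-1) 1 ∪ E (-1) (-1))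
  have h3 := measureReal_union_le (μ := P) (E 1 1) (E 1 (-1))
  have h4 := measureReal_union_le (μ := P) (E (-1) 1) (E (-1) (-1))
  have q1 : P.real (E 1 1) ≤ q := hq 1 1 (by norm_num) (by norm_num)
  have q2 : P.real (E 1 (-1)) ≤ q := hq 1 (-1) (by norm_num) (by norm_num)
  have q3 : P.real (E (-1) 1) ≤ q := hq (-1) 1 (by norm_num) (by norm_num)
  have q4 : P.real (E (-1) (-1)) ≤ q := hq (-1) (-1) (by norm_num) (by norm_num)
  linarith

end

/-! ### Choice of scales and conclusion -/

/-- A polynomial prefactor is absorbed by a stretched exponential. -/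
theorem eventually_mul_rpow_mul_exp_le {β c : ℝ} (hβ : 0 < β) (hc : 0 < c) (K γ : ℝ) :
    ∀ᶠ r : ℝ in atTop,
      K * r ^ γ * Real.exp (-(c * r ^ β)) ≤ Real.exp (-(c / 2) * r ^ β) := by
  have h1 := (tendsto_rpow_mul_exp_neg_mul_atTop_nhds_zero (γ / β) (c / 2) (by positivity)).comp
    (tendsto_rpow_atTop hβ)
  have h2 := h1.const_mul K
  rw [mul_zero] at h2
  filter_upwards [h2.eventually_le_const one_pos, eventually_gt_atTop 0] with r hr hr0
  simp only [Function.comp_apply] at hr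
  rw [← Real.rpow_mul hr0.le, mul_div_cancel₀ _ hβ.ne'] at hr
  calc K * r ^ γ * Real.exp (-(c * r ^ β))
      = (K * (r ^ γ * Real.exp (-(c / 2) * r ^ β))) * Real.exp (-(c / 2) * r ^ β) := by
        rw [show -(c * r ^ β) = -(c / 2) * r ^ β + -(c / 2) * r ^ β by ring, Real.exp_add]
        ring
    _ ≤ 1 * Real.exp (-(c / 2) * r ^ β) := by gcongr
    _ = _ := one_mul _

/-- The main estimate for a pair of ordered intervals. -/
theorem exists_ordered_gap_bound {Ω : Type*} [MeasurableSpace Ω] {P : Measure Ω}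
    {f : ℝ → Ω → ℝ} (hf : IsSGP P f) (hC1 : IsC1Process P f) {c₀ α : ℝ} (hc₀ : 0 < c₀)
    (hα : 1 < α) (hK : ∀ x : ℝ, x ≠ 0 → |covKernel P f x| ≤ c₀ * |x| ^ (-α))
    {ε : ℝ} (hε : 0 < ε) (hε1 : ε ≤ 1) :
    ∃ K κ : ℝ, 0 < K ∧ 0 < κ ∧ ∀ r : ℝ, 1 ≤ r → ∀ a b c d : ℝ, b ≤ c → r ≤ b - a → r ≤ d - c →
      P.real (gapEvent f (Icc a b) ∩ gapEvent f (Icc c d)) ≤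
        4 * P.real {ω | ∀ x ∈ Icc (0 : ℝ) ((1 - ε) * r), -ε < f x ω} ^ 2 +
          K * r ^ (1 + (α - 1) / 2) * Real.exp (-(κ * r ^ ((α - 1) / 2))) := by
  have := hf.gaussian.isProbabilityMeasure
  obtain ⟨C, κ₁, hC, hκ₁, hB⟩ := exists_incrementEvent_tail hf hC1
  obtain ⟨β, hβ⟩ : ∃ β, β = (α - 1) / 2 := ⟨_, rfl⟩
  rw [← hβ]
  have hβ0 : 0 < β := by rw [hβ]; linarith
  let k₀ : ℝ := c₀ * (2 * ε) ^ (-α)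
  have hk₀ : 0 < k₀ := by positivity
  -- The first bound serves the quotient tail at height `(ε / 2) * R`, using `R ≤ R ^ 2`; the second
  -- serves the sprinkling noise at `t = ε / 4`, with `192 = 12 * 16`.
  let κ : ℝ := min (κ₁ * (ε / 2) ^ 2) (ε ^ 2 / (192 * k₀))
  have hκ : 0 < κ := by positivity
  refine ⟨24 * C + 48, κ, by positivity, hκ, fun r hr a b c d hbc hab hcd => ?_⟩
  have hr0 : 0 < r := by linarith
  let R : ℝ := r ^ β
  have hR1 : 1 ≤ R := Real.one_le_rpow hr hβ0.le
  have hR0 : 0 < R := by linarith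
  let h : ℝ := R⁻¹
  have hh0 : 0 < h := by positivity
  have hh1 : h ≤ 1 := inv_le_one_of_one_le₀ hR1
  let n : ℕ := ⌈r * R⌉₊
  have hnr : r * R ≤ n := Nat.le_ceil _
  have hrR : 1 ≤ r * R := one_le_mul_of_one_le_of_one_le hr hR1
  have hn3 : (n : ℝ) + 1 ≤ 3 * (r * R) := by
    have := Nat.ceil_lt_add_one (show 0 ≤ r * R by positivity)
    simp only [n]
    linarith
  have hrpow : r ^ (1 + β) = r * R := by rw [Real.rpow_add hr0, Real.rpow_one]
  let L : ℝ := (1 - ε) * r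
  have hL0 : 0 ≤ L := mul_nonneg (by linarith) hr0.le
  have hLr : L = r - ε * r := by simp only [L]; ring
  have hεr : 0 < ε * r := by positivity
  have hnL : L ≤ n * h := by
    have : r ≤ n * h := by
      rw [show n * h = n / R from rfl, le_div_iff₀ hR0]; exact hnr
    linarith
  let e : ℝ := Real.exp (-(κ * R))
  have hBe : ∀ s, P.real (incrementEvent f s (ε / 2 * R)) ≤ C * e := fun s => by
    refine (hB s _ (by positivity)).trans ?_
    have h1 : κ ≤ κ₁ * (ε / 2) ^ 2 := min_le_left _ _
    have h2 : κ * R ≤ κ₁ * (ε / 2 * R) ^ 2 := by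
      have : κ * R ≤ (κ₁ * (ε / 2) ^ 2) * R ^ 2 :=
        mul_le_mul h1 (by nlinarith) hR0.le (by positivity)
      linarith
    exact mul_le_mul_of_nonneg_left (Real.exp_le_exp.2 (by linarith)) hC.le
  have hpers := measureReal_lattice_le hf hC1 (u := ε / 2 * R) hh0 hh1 hnL (by positivity)
    (by simp only [h]; rw [mul_assoc, mul_inv_cancel₀ hR0.ne', mul_one]) hBe
  let k : ℝ := k₀ * r ^ (-α)
  have hk : 0 < k := by positivity
  have hlat : ∀ i : Fin (n + 1), latticePoint h L i ∈ Icc 0 L :=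
    fun i => latticePoint_mem hh0.le hL0 i
  have hcov : ∀ i j : Fin (n + 1),
      |covKernel P f (d - L + latticePoint h L j - (a + latticePoint h L i))| ≤ k := by
    intro i j
    have hi := hlat i
    have hj := hlat j
    -- Since `b ≤ c`, `d - a ≥ 2 * r`, and the two kept pieces use up `2 * L`.
    have hx : 2 * ε * r ≤ d - L + latticePoint h L j - (a + latticePoint h L i) := by
      linarith [hi.2, hj.1]
    have hx0 : 0 < d - L + latticePoint h L j - (a + latticePoint h L i) := by linarith
    refine (hK _ hx0.ne').trans ?_
    rw [abs_of_pos hx0]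
    have h1 := Real.rpow_le_rpow_of_nonpos (by positivity) hx (show -α ≤ 0 by linarith)
    rw [Real.mul_rpow (by positivity) hr0.le] at h1
    simp only [k, k₀]
    rw [mul_assoc]
    exact mul_le_mul_of_nonneg_left h1 hc₀.le
  have hexp : Real.exp (-((ε / 4) ^ 2) / (2 * (2 * (Fintype.card (Fin (n + 1)) : ℝ) * k))) ≤ e := by
    have hcard : (Fintype.card (Fin (n + 1)) : ℝ) = n + 1 := by simp
    rw [hcard, neg_div]
    refine Real.exp_le_exp.2 (neg_le_neg ?_)
    -- This identity fixes the exponent `β`: it amounts to `1 + 2 * β = α`.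
    have hra : R * (r * R) * r ^ (-α) = 1 := by
      simp only [R]
      rw [show r ^ β * (r * r ^ β) = r ^ β * (r ^ (1 : ℝ) * r ^ β) by rw [Real.rpow_one],
        ← Real.rpow_add hr0, ← Real.rpow_add hr0, ← Real.rpow_add hr0,
        show β + (1 + β) + -α = 0 by rw [hβ]; ring, Real.rpow_zero]
    rw [le_div_iff₀ (by positivity)]
    have h1 : κ * (192 * k₀) ≤ ε ^ 2 := (le_div_iff₀ (by positivity)).1 (min_le_right _ _)
    calc κ * R * (2 * (2 * (n + 1) * k)) ≤ κ * R * (2 * (2 * (3 * (r * R)) * k)) := by gcongr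
      _ = κ * (12 * k₀) * (R * (r * R) * r ^ (-α)) := by simp only [k]; ring
      _ = κ * (192 * k₀) / 16 := by rw [hra]; ring
      _ ≤ (ε / 4) ^ 2 := by linarith
  let Q : ℝ := P.real {ω | ∀ i : Fin (n + 1), -(ε / 2) < f (latticePoint h L i) ω}
  have hgap := measureReal_gap_inter_gap_le (P := P) hC1 (a := a) (b := b) (c := c) (d := d)
    (fun i : Fin (n + 1) => a + latticePoint h L i)
    (fun i : Fin (n + 1) => d - L + latticePoint h L i)
    (fun i => ⟨by linarith [(hlat i).1], by linarith [(hlat i).2]⟩)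
    (fun i => ⟨by linarith [(hlat i).1], by linarith [(hlat i).2]⟩)
    (q := Q ^ 2 + 12 * (r * R) * e) (fun σ τ hσ hτ => by
      have h1 := measureReal_signed_pos_and_le hf (fun i : Fin (n + 1) => latticePoint h L i) hσ hτ
        a (d - L) hk hcov (show 0 ≤ ε / 4 by positivity)
      rw [show 2 * (ε / 4) = ε / 2 by ring] at h1
      refine h1.trans (add_le_add le_rfl ?_)
      calc _ ≤ 2 * (2 * (Fintype.card (Fin (n + 1)) : ℝ) * e) := by gcongr
        _ = 4 * (n + 1) * e := by simp; ring
        _ ≤ 4 * (3 * (r * R)) * e := by gcongr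
        _ = 12 * (r * R) * e := by ring)
  let p : ℝ := P.real {ω | ∀ x ∈ Icc (0 : ℝ) L, -ε < f x ω}
  have hp0 : 0 ≤ p := measureReal_nonneg
  have hp1 : p ≤ 1 := measureReal_le_one
  have hQ0 : 0 ≤ Q := measureReal_nonneg
  have hQ1 : Q ≤ 1 := measureReal_le_one
  have he : 0 < e := Real.exp_pos _
  have hQp : Q ≤ p + 3 * (r * R) * (C * e) := hpers.trans (by gcongr)
  -- If `Q ≥ p`, factor `Q ^ 2 - p ^ 2` and use `Q + p ≤ 2`.
  have hQ2 : Q ^ 2 ≤ p ^ 2 + 6 * (r * R) * (C * e) := by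
    have h0 : 0 ≤ 3 * (r * R) * (C * e) := by positivity
    nlinarith
  rw [hrpow]
  change _ ≤ 4 * p ^ 2 + (24 * C + 48) * (r * R) * e
  nlinarith

theorem proposition4p2 {Ω : Type*} [MeasurableSpace Ω] (P : Measure Ω) [IsProbabilityMeasure P]
    (f : ℝ → Ω → ℝ) (hf : IsSGP P f) (hC1 : IsC1Process P f)
    (c₀ α : ℝ) (hc₀ : 0 < c₀) (hα : 1 < α)
    (hK : ∀ x : ℝ, x ≠ 0 → |covKernel P f x| ≤ c₀ * |x| ^ (-α))
    (ε : ℝ) (hε : 0 < ε) :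
    ∃ c₁ : ℝ, 0 < c₁ ∧ ∃ r₀ : ℝ, ∀ r : ℝ, r₀ ≤ r →
      clusteringCoeff P f r ≤
        4 * P.real {ω : Ω | ∀ x ∈ Icc (0 : ℝ) ((1 - ε) * r), -ε < f x ω} ^ 2
          + Real.exp (-c₁ * r ^ ((α - 1) / 2)) := by
  rcases lt_or_ge 1 ε with hε1 | hε1
  · refine ⟨1, one_pos, 1, fun r hr => ?_⟩
    have hempty : Icc (0 : ℝ) ((1 - ε) * r) = ∅ := Icc_eq_empty (by nlinarith)
    have hle : clusteringCoeff P f r ≤ 1 := by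
      refine Real.sSup_le ?_ zero_le_one
      rintro _ ⟨p, -, rfl⟩
      exact measureReal_le_one
    have he := Real.exp_pos (-1 * r ^ ((α - 1) / 2))
    simp only [hempty, mem_empty_iff_false, false_imp_iff, implies_true, ofPred_true, probReal_univ]
    linarith
  obtain ⟨K, κ, hKpos, hκ, hgap⟩ := exists_ordered_gap_bound hf hC1 hc₀ hα hK hε hε1
  obtain ⟨r₀, hr₀⟩ := eventually_atTop.1 (eventually_mul_rpow_mul_exp_le
    (show 0 < (α - 1) / 2 by linarith) hκ K (1 + (α - 1) / 2))
  refine ⟨κ / 2, by positivity, max r₀ 1, fun r hr => ?_⟩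
  have hr1 : 1 ≤ r := (le_max_right _ _).trans hr
  have herr := hr₀ r ((le_max_left _ _).trans hr)
  refine Real.sSup_le ?_ (by positivity)
  rintro _ ⟨_, ⟨a, b, c, d, hab, hcd, rfl, hrab, hrcd, hsub⟩, rfl⟩
  refine le_trans ?_ (add_le_add le_rfl herr)
  rcases le_or_gt b c with hbc | hbc
  · exact hgap r hr1 a b c d hbc hrab hrcd
  rcases le_or_gt d a with hda | hda
  · simp only
    rw [inter_comm]
    exact hgap r hr1 c d a b hda hrcd hrab
  -- The remaining case is a genuine overlap, which contains two distinct points.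
  · have hlt : max a c < min b d :=
      max_lt (lt_min (by linarith) hda) (lt_min hbc (by linarith))
    have h1 : max a c ∈ Icc a b ∩ Icc c d :=
      ⟨⟨le_max_left _ _, (hlt.trans_le (min_le_left _ _)).le⟩,
        ⟨le_max_right _ _, (hlt.trans_le (min_le_right _ _)).le⟩⟩
    have h2 : min b d ∈ Icc a b ∩ Icc c d :=
      ⟨⟨(le_max_left _ _).trans hlt.le, min_le_left _ _⟩,
        ⟨(le_max_right _ _).trans hlt.le, min_le_right _ _⟩⟩
    exact absurd (hsub h1 h2) hlt.ne
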